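/- **Model.** A circuit is a finite set of gates on named registers, each register classical or quantum. A gate is a permutation of the values of classical registers, a unitary on quantum registers, or a measurement whose outcome is stored in a fresh classical register. A gate can be controlled by classical bits, and it can be conditioned on an activation register, in which case it comes after the gates that set this register. The gates of a circuit are partially ordered, causally, in a way that can depend on the values of its own control bits; for all such values, two gates that access a same register (a control register, or a target register of an active gate) are ordered. $A+B$ is the union of the sets of gates and of the order relations. A protocol is a finite union of role-circuits, which share channel registers. Each channel has a type that says how the environment can access it; the input/output channels are shared with the environment. A corruptible role-circuit $r$ has a corruption bit $C_r$, and its gates do nothing when $C_r=1$. A valid environment $E$ for $P$ consists of gates on its own registers, among them an output bit $Z$, that can also use the input/output channels and corruption bits of $P$, access the other channels as their types permit, and access all registers of a corruptible $r$, and communicate in its name, with gates that are active only if $C_r=1$. It also chooses the order of the communication gates of $P$, and $E+P$ must be a circuit. An ideal protocol $I(P)$ associated with $P$ is a protocol with its own internal registers. It uses the input/output channels and the corruption bits of $P$, and for every role-circuit $r$ of $P$ with input/output it has one, with the same corruption bit, that uses the input/output channels of $r$. A valid simulator $S$ is a set of gates that supplies the registers and channels of $P$ to $E$, accesses $I(P)$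 as an adversary (in particular, its input/output only in the name of corrupted circuits), and does not change corruption bits; $E+I(P)+S$ must be a circuit. For $\varepsilon=\varepsilon(n,E)$, where $n$ is the security parameter, $P$ *$\varepsilon$-securely realizes* $I(P)$ if for every $n$ and every valid environment $E$ for $P$ there is a valid simulator $S$ with $$\bigl|\Pr(Z_{E+P}=0)-\Pr(Z_{E+I(P)+S}=0)\bigr|\le\varepsilon(n,E).$$ **Theorem.** Let $P$ be a protocol with a finite tree of sub-protocols $Q=M(Q)+\sum_{R\in\mathcal C(Q)}R$, where $M(Q)$ is the main module of $Q$, $\mathcal C(Q)$ is the set of sub-protocols that it calls, and distinct modules communicate only through the input/output channels between a caller and the modules it calls. Let $I(Q)$ be an ideal protocol associated with $Q$, and let $\widetilde Q=M(Q)+\sum_{R\in\mathcal C(Q)}I(R)$. (The protocol, the tree and the $I(Q)$ may depend on $n$. Internal registers and gates of distinct modules and ideal protocols have distinct names, reserved for them, except that a gate of $I(Q)$ may take the name, and so the place in the order, of a gate of $M(Q)$.) Suppose that, for every sub-protocol $Q$ of $P$ (including $P$ itself), $\widetilde Q$ $\varepsilon_{\widetilde Q}$-securely realizes $I(Q)$,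 where $\varepsilon_{\widetilde Q}=\varepsilon_{\widetilde Q}(n,E)$ may depend on the environment. Then there are simulators $S_Q(n,E)$, as functions of the environment, that witness this for all $Q$. Moreover, fix any such choice and any bottom-up traversal of the tree. For a valid environment $E$ for $P$, define $E(\widetilde Q)$ recursively along the traversal as $$E(\widetilde Q)=E+\sum_{R>Q}M(R)+\sum_{R}I(R)+\sum_{R<Q}S_R(n,E(\widetilde R)),$$ where $<$ is the traversal order and the middle sum is over the $R<Q$ whose caller is visited after $Q$. Then $P$ $\varepsilon_P$-securely realizes $I(P)$, with $$\varepsilon_P(n,E)=\sum_{Q}\varepsilon_{\widetilde Q}(n,E(\widetilde Q)).$$ -/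

import Mathlib

/-! ### Registers, configurations and gates -/

/-- A register: a name, its nature (classical or quantum), and its set of basis values
`{0, …, top}`. The registers with a given name of different nature or size are distinct. -/
structure Reg where
  id : ℕ
  classical : Bool
  top : ℕ
deriving DecidableEq

/-- The basis values of a register. -/
abbrev Reg.Val (v : Reg) : Type := Fin (v.top + 1)

/-- A classical bit. -/
def Reg.IsBit (v : Reg) : Prop := v.classical = true ∧ v.top = 1

/-- Computational basis states of all registers together. -/
abbrev Config : Type := (v : Reg) → v.Val

/-- Computational basis states of the registers in a finite set. -/
abbrev LocalConfig (s : Finset Reg) : Type := (v : s) → v.1.Val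

/-- State vectors (the reachable ones have finite support). -/
abbrev QState : Type := Config → ℂ

/-- All registers initially contain `0`; for a corruption register this means "not corrupted", for
an activation register it means `SLEEP`. -/
noncomputable def initialState : QState :=
  open Classical in fun b => if b = fun _ => 0 then 1 else 0

/-- Overwrite a configuration on a finite set of registers. -/
def Config.patch {s : Finset Reg} (b : Config) (y : LocalConfig s) : Config :=
  fun v => if h : v ∈ s then y ⟨v, h⟩ else b v

/-- A (controlled) gate. Its controlled part is the unitary `U` on the target registers `tgt`; it is
active when every control bit `c` with `(c, a) ∈ ctrl` has the value `a`, and otherwise the gate is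
the identity. A gate is of one of three types:
* a classical gate: a permutation of the values of classical registers;
* a quantum gate: a unitary on quantum registers (classical ones can only be control bits);
* a measurement: a unitary on quantum registers and one classical register `X`, `outcome = some X`.
  As `X` is fresh (see `Component.IsCircuit`), the gate maps `ψ ⊗ |0⟩` to `∑ x, K x ψ ⊗ |x⟩` with
  `∑ x, (K x)ᴴ (K x) = 1`.
If `wake = some a`, then `a` is the activation register of the gate, which is only executed once `a`
contains `1` (`WAKE-UP`). -/
structure Gate where
  id : ℕ
  ctrl : Finset (Reg × ℕ)
  tgt : Finset Reg
  wake : Option Reg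
  outcome : Option Reg
  U : Matrix (LocalConfig tgt) (LocalConfig tgt) ℂ
  unitary : U ∈ Matrix.unitaryGroup (LocalConfig tgt) ℂ
  ctrl_bit : ∀ c ∈ ctrl, c.1.IsBit ∧ c.1 ∉ tgt
  wake_ctrl : ∀ a, wake = some a → (a, 1) ∈ ctrl
  unmeasured : outcome = none →
    ((∀ v ∈ tgt, v.classical = true) ∧
      ∃ σ : Equiv.Perm (LocalConfig tgt), U = σ.permMatrix ℂ) ∨
    (∀ v ∈ tgt, v.classical = false)
  measured : ∀ X, outcome = some X →
    X ∈ tgt ∧ X.classical = true ∧ ∀ v ∈ tgt, v ≠ X → v.classical = false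

namespace Gate

/-- The control registers. -/
def ctrlRegs (g : Gate) : Finset Reg := g.ctrl.image Prod.fst

/-- All registers on which the gate is defined. -/
def regs (g : Gate) : Finset Reg := g.ctrlRegs ∪ g.tgt

/-- The registers accessed by the gate when `x` is the set of the names of the active gates: the
control registers, and the targets only if the controlled part is active. -/
def access (g : Gate) (x : Finset ℕ) : Finset Reg :=
  if g.id ∈ x then g.ctrlRegs ∪ g.tgt else g.ctrlRegs

/-- The gate does not change the value of `v` in the computational basis (it can read `v`). -/
def Preserves (g : Gate) (v : Reg) : Prop :=
  ∀ h : v ∈ g.tgt, ∀ y z : LocalConfig g.tgt, g.U y z ≠ 0 → y ⟨v, h⟩ = z ⟨v, h⟩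

/-- The control bits activate the gate. -/
def On (g : Gate) (b : Config) : Prop := ∀ c ∈ g.ctrl, (b c.1 : ℕ) = c.2

/-- Execution of a gate in the branch where its control bits are found to activate it, if
`active`, or not to activate it, otherwise: projection on this event, and the action of the gate. -/
noncomputable def step (g : Gate) (active : Prop) (ψ : QState) : QState :=
  open Classical in fun b =>
    if active then
      if g.On b then ∑ y : LocalConfig g.tgt, g.U (fun v => b v.1) y * ψ (b.patch y) else 0
    else if g.On b then 0 else ψ b

end Gate

/-! ### Circuits -/

/-- A finite set of gates with an ordering relation that depends on the values of the control
registers of its gates, recorded as the set `x` of (the names of) the gates whose controlled part is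
active. Only the activity of the component's own gates matters. The relation can involve gates of
other components: it is used in a union of components, on the gates that are present there. -/
structure Component where
  gates : Finset Gate
  rel : Finset ℕ → ℕ → ℕ → Prop
  rel_own : ∀ x, rel x = rel (x ∩ gates.image Gate.id)

namespace Component

/-- The names of the gates. -/
def ids (A : Component) : Finset ℕ := A.gates.image Gate.id

/-- The union of a finite family of components. -/
noncomputable def sum {ι : Type} (s : Finset ι) (F : ι → Component) : Component where
  gates := open Classical in s.biUnion fun i => (F i).gates
  rel x a b := ∃ i ∈ s, (F i).rel x a b
  rel_own x := by
    classical
    funext a b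
    refine propext (exists_congr fun i => and_congr_right fun hi => ?_)
    rw [(F i).rel_own x, (F i).rel_own (x ∩ (s.biUnion fun i => (F i).gates).image Gate.id)]
    have hsub : (F i).gates.image Gate.id ⊆
        (s.biUnion fun i => (F i).gates).image Gate.id :=
      Finset.image_subset_image fun g hg => Finset.mem_biUnion.2 ⟨i, hi, hg⟩
    rw [Finset.inter_assoc, Finset.inter_eq_right.2 hsub]

/-- The union `A + B` of two components. -/
noncomputable instance : Add Component where
  add A B :=
    { gates := open Classical in A.gates ∪ B.gates
      rel := fun x a b => A.rel x a b ∨ B.rel x a b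
      rel_own := by
        classical
        intro x
        funext a b
        have hA : A.gates.image Gate.id ⊆ (A.gates ∪ B.gates).image Gate.id :=
          Finset.image_subset_image Finset.subset_union_left
        have hB : B.gates.image Gate.id ⊆ (A.gates ∪ B.gates).image Gate.id :=
          Finset.image_subset_image Finset.subset_union_right
        rw [A.rel_own x, B.rel_own x, A.rel_own (x ∩ (A.gates ∪ B.gates).image Gate.id),
          B.rel_own (x ∩ (A.gates ∪ B.gates).image Gate.id),
          Finset.inter_assoc, Finset.inter_assoc, Finset.inter_eq_right.2 hA,
          Finset.inter_eq_right.2 hB] }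

/-- The empty component. -/
instance : Zero Component where
  zero := ⟨∅, fun _ _ _ => False, fun _ => rfl⟩

/-- The ordering of the gates that are present: the transitive closure of the relation on them. -/
def before (A : Component) (x : Finset ℕ) : ℕ → ℕ → Prop :=
  Relation.TransGen fun a b => A.rel x a b ∧ a ∈ A.ids ∧ b ∈ A.ids

/-- For all values of the control registers, the gates are partially ordered, and two gates that
access a same register are an ordered pair. The order is causal: which gates come before a given
gate can only depend on the control values of the gates that come before it. -/
structure IsOrdered (A : Component) : Prop where
  id_inj : Set.InjOn Gate.id (A.gates : Set Gate)
  irrefl : ∀ x a, ¬ A.before x a a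
  comparable : ∀ x, ∀ g ∈ A.gates, ∀ h ∈ A.gates, g ≠ h →
    (∃ v, v ∈ g.access x ∧ v ∈ h.access x) → A.rel x g.id h.id ∨ A.rel x h.id g.id
  causal : ∀ x y c, (∀ a, A.before x a c → (a ∈ x ↔ a ∈ y)) →
    ∀ a, A.before y a c ↔ A.before x a c

/-- `L` lists all the gates in an order that is compatible with the partial order for `x`. -/
def IsSchedule (A : Component) (x : Finset ℕ) (L : List Gate) : Prop :=
  L.Nodup ∧ (∀ g, g ∈ L ↔ g ∈ A.gates) ∧ L.Pairwise fun g h => ¬ A.before x h.id g.id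

/-- Execution of a list of gates from the initial state, in the branch where the active gates are
those with a name in `x`. The squared norm of the result is the probability of this branch. -/
noncomputable def run (x : Finset ℕ) (L : List Gate) : QState :=
  L.foldl (fun ψ g => g.step (g.id ∈ x) ψ) initialState

/-- The control values recorded by `x` occur with nonzero probability. -/
def Possible (A : Component) (x : Finset ℕ) : Prop :=
  ∃ L, A.IsSchedule x L ∧ run x L ≠ 0

/-- A circuit that can be executed. In addition to the order constraints, a gate comes after the
gates that set its activation register, and the outcome register of a measurement is not accessed
before the measurement. -/
structure IsCircuit (A : Component) : Prop extends A.IsOrdered where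
  wake : ∀ x, A.Possible x → ∀ g ∈ A.gates, ∀ h ∈ A.gates, g ≠ h → ∀ a, g.wake = some a →
    h.id ∈ x → a ∈ h.tgt → ¬ h.Preserves a → A.before x h.id g.id
  fresh : ∀ x, A.Possible x → ∀ g ∈ A.gates, ∀ h ∈ A.gates, g ≠ h → ∀ X, g.outcome = some X →
    g.id ∈ x → X ∈ h.access x → A.before x g.id h.id

/-- An execution order for each value of the control registers. In a circuit all the possible
choices give the same result, because gates that are not ordered act on disjoint registers. -/
noncomputable def schedule (A : Component) (x : Finset ℕ) : List Gate :=
  Classical.epsilon (A.IsSchedule x)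

/-- The probability that the register `Z` contains `0` at the end of the execution: the sum over the
values of the control registers of the probability that they occur and that `Z = 0`. -/
noncomputable def probZero (A : Component) (Z : Reg) : ℝ :=
  ∑ x ∈ A.ids.powerset,
    ∑' b : Config, if (b Z : ℕ) = 0 then ‖run x (A.schedule x) b‖ ^ 2 else 0

end Component

/-! ### Protocols -/

/-- A module-role-circuit: a circuit executed by a participant, the registers associated with it,
and its corruption register if it is corruptible. -/
structure Role extends Component where
  regs : Finset Reg
  corr : Option Reg

/-- A protocol: a finite set of role-circuits, together with the set `names` of the names that are
reserved for its gates and for its internal registers, its internal channel registers `chan`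
(activation registers shared by several roles included), and the channel types: the environment can
read the classical values of the channels in `readable`, it can use those in `writable` freely, and
it has no access to the other ones. A register of a role whose name is not in `names` and which is
not its corruption register is an input/output channel register, shared with the environment. -/
structure Protocol where
  roles : Finset Role
  names : Set ℕ
  chan : Set Reg
  readable : Set Reg
  writable : Set Reg

namespace Protocol

/-- The union of a finite family of protocols. -/
noncomputable def sum {ι : Type} (s : Finset ι) (F : ι → Protocol) : Protocol where
  roles := open Classical in s.biUnion fun i => (F i).roles
  names := ⋃ i ∈ s, (F i).names
  chan := ⋃ i ∈ s, (F i).chan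
  readable := ⋃ i ∈ s, (F i).readable
  writable := ⋃ i ∈ s, (F i).writable

/-- The union `P + Q` of two protocols. -/
noncomputable instance : Add Protocol where
  add P Q :=
    { roles := open Classical in P.roles ∪ Q.roles
      names := P.names ∪ Q.names
      chan := P.chan ∪ Q.chan
      readable := P.readable ∪ Q.readable
      writable := P.writable ∪ Q.writable }

/-- The gates of a protocol, with the order inside each role-circuit. -/
noncomputable def toComponent (P : Protocol) : Component where
  gates := open Classical in P.roles.biUnion fun r => r.gates
  rel x a b := ∃ r ∈ P.roles, r.rel x a b
  rel_own := (Component.sum P.roles fun r => r.toComponent).rel_own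

/-- The input/output channel registers of a role. -/
def io (P : Protocol) (r : Role) : Set Reg :=
  {v | v ∈ r.regs ∧ v.id ∉ P.names ∧ r.corr ≠ some v}

/-- The rules that every protocol obeys. -/
structure WellFormed (P : Protocol) : Prop where
  /-- Each role is a circuit on its registers; its gates have reserved names, and its order only
  concerns its own gates. -/
  role_circuit : ∀ r ∈ P.roles, r.IsOrdered ∧
    (∀ g ∈ r.gates, g.id ∈ P.names ∧ g.regs ⊆ r.regs) ∧
    ∀ x a b, r.rel x a b → a ∈ r.ids ∧ b ∈ r.ids
  /-- Distinct roles have distinct gates. -/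
  role_disjoint : ∀ r ∈ P.roles, ∀ r' ∈ P.roles, r ≠ r' → Disjoint r.ids r'.ids
  /-- The corruption register of a role is a classical bit, controlled by the environment; every gate
  of the role does nothing when it is on. -/
  corruptible : ∀ r ∈ P.roles, ∀ c, r.corr = some c →
    c.IsBit ∧ c ∈ r.regs ∧ c.id ∉ P.names ∧ ∀ g ∈ r.gates, (c, 0) ∈ g.ctrl
  /-- A corruption register is only used to corrupt; no gate of the protocol acts on it. -/
  corr_only : ∀ r ∈ P.roles, ∀ c, r.corr = some c → ∀ r' ∈ P.roles, c ∈ r'.regs →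
    r'.corr = some c ∧ ∀ g ∈ r'.gates, c ∉ g.tgt
  /-- Internal channels have reserved names, and only channels have a type. -/
  chan_names : ∀ v ∈ P.chan, v.id ∈ P.names
  types : P.readable ⊆ P.chan ∧ P.writable ⊆ P.chan ∧ ∀ v ∈ P.readable, v.classical = true
  /-- Internal registers shared by distinct roles are channel registers. -/
  shared : ∀ r ∈ P.roles, ∀ r' ∈ P.roles, r ≠ r' → ∀ v, v ∈ r.regs → v ∈ r'.regs →
    v.id ∈ P.names → v ∈ P.chan
  /-- A gate that accesses a channel register is a communication gate: it has an activation
  register. -/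
  communication : ∀ r ∈ P.roles, ∀ g ∈ r.gates, ∀ v ∈ g.regs, v ∈ P.chan ∪ P.io r →
    g.wake.isSome

/-- The access of a gate `g` from outside the protocol to the register `v` of the protocol is
permitted: `v` is a channel register and the channel type permits it, or `g` belongs to the adversary
circuit of a corruptible role `r`: it is only active when `r` is corrupted, and it can then access
all registers of `r`, and communicate in its name. -/
def Permits (P : Protocol) (g : Gate) (v : Reg) : Prop :=
  v ∈ P.writable ∨ (v ∈ P.readable ∧ g.Preserves v) ∨
    ∃ r ∈ P.roles, ∃ c, r.corr = some c ∧ (c, 1) ∈ g.ctrl ∧ v ∈ r.regs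

end Protocol

/-! ### Environments, ideal protocols, simulators -/

/-- An environment: a component with an output register. -/
structure Env extends Component where
  Z : Reg

/-- `E` is a valid environment for `P`: it has its own gates, its own registers (whose names are not
reserved for `P`), among them the output bit `Z`, and the other registers of `P` are only accessed as
`P` permits; the input/output channels and the corruption registers are at its disposal. The relation
of `E` includes the choice of an order for the communication gates of `P`, and `E + P` is a
circuit. -/
structure ValidEnv (P : Protocol) (E : Env) : Prop where
  output : E.Z.IsBit ∧ E.Z.id ∉ P.names ∧ ∀ r ∈ P.roles, E.Z ∉ r.regs
  own_gates : ∀ g ∈ E.gates, g.id ∉ P.names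
  permitted : ∀ g ∈ E.gates, ∀ v ∈ g.regs, v.id ∈ P.names → P.Permits g v
  order : ∀ x a b, E.rel x a b →
    (a ∈ P.names → a ∈ P.toComponent.ids) ∧ (b ∈ P.names → b ∈ P.toComponent.ids)
  circuit : (E.toComponent + P.toComponent).IsCircuit

/-- `I` can be associated with `P` as an ideal protocol. Its internal names are reserved for `P` but
not used by its registers or channels (there remain infinitely many names for a simulator); only an
ideal gate that corresponds to a gate of `P` can share the name of the latter. A role `I(r)` has the
corruption register of a role `r` of `P`, and it can use the input/output channels of `r`; every
role of `P` with input/output has such a counterpart. -/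
structure IsIdealFor (P I : Protocol) : Prop where
  names_subset : I.names ⊆ P.names
  names_infinite : (P.names \ I.names).Infinite
  gate_names : ∀ a ∈ P.toComponent.ids, a ∈ I.names → a ∈ I.toComponent.ids
  reg_names : ∀ r ∈ P.roles, ∀ v ∈ r.regs, v.id ∉ I.names
  chan_names : ∀ v ∈ P.chan, v.id ∉ I.names
  corr : ∀ r' ∈ I.roles, ∀ c, r'.corr = some c → ∃ r ∈ P.roles, r.corr = some c
  io_of_ideal : ∀ r' ∈ I.roles, ∀ v ∈ I.io r', ∃ r ∈ P.roles, r.corr = r'.corr ∧ v ∈ P.io r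
  io_of_real : ∀ r ∈ P.roles, ∀ v ∈ P.io r, ∃ r' ∈ I.roles, r'.corr = r.corr ∧ v ∈ I.io r'

/-- `S` is a valid simulator for the protocol `P`, the ideal protocol `I` and the environment `E`.
It has its own gates and registers, with names reserved for `P` and not for `I`. The registers and
channels of `P`, as `E` knows them, are among these: the simulator provides them in the place of `P`,
and its gates can take the names of the gates of `P`, and so their position relative to `E`. It
accesses the ideal protocol as an adversary, in particular the input/output channels only in the name
of corrupted circuits; it can read, but not change, the corruption registers. -/
structure ValidSim (P I : Protocol) (E : Env) (S : Component) : Prop where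
  own_gates : ∀ g ∈ S.gates, g.id ∈ P.names ∧ g.id ∉ I.names
  permitted : ∀ g ∈ S.gates, ∀ v ∈ g.regs,
    (v.id ∈ P.names ∧ v.id ∉ I.names) ∨
    ((∃ r, (r ∈ P.roles ∨ r ∈ I.roles) ∧ r.corr = some v) ∧ g.Preserves v) ∨
    ((∀ r, r ∈ P.roles ∨ r ∈ I.roles → r.corr ≠ some v) ∧ I.Permits g v)
  order : ∀ x a b, S.rel x a b → ∀ d, d = a ∨ d = b →
    (d ∈ S.ids ∨ d ∈ E.ids ∨ d ∈ P.names) ∧ (d ∈ I.names → d ∈ I.toComponent.ids)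
  circuit : (E.toComponent + I.toComponent + S).IsCircuit

/-- The difference `|Pr(Z_{E + P} = 0) - Pr(Z_{E + I + S} = 0)|`. -/
noncomputable def advantage (P I : Protocol) (E : Env) (S : Component) : ℝ :=
  |(E.toComponent + P.toComponent).probZero E.Z -
    (E.toComponent + I.toComponent + S).probZero E.Z|

/-- `P` `ε`-securely realizes `I`, for a fixed value of the security parameter: the error is a
function of the environment. -/
def SecurelyRealizes (P I : Protocol) (ε : Env → ℝ) : Prop :=
  ∀ E, ValidEnv P E → ∃ S, ValidSim P I E S ∧ advantage P I E S ≤ ε E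

/-- The map `σ`, from environments to simulators, witnesses that `P` `ε`-securely realizes `I`. -/
def Simulates (P I : Protocol) (ε : Env → ℝ) (σ : Env → Component) : Prop :=
  ∀ E, ValidEnv P E → ValidSim P I E (σ E) ∧ advantage P I E (σ E) ≤ ε E

/-! ### Trees of sub-protocols -/

/-- A protocol as a tree of modules, each of which has an associated ideal protocol. The nodes are
numbered in the order of a bottom-up traversal: a node comes before its parent, the root is last.
All trees, and all their bottom-up traversals, are obtained in this way. -/
structure ProtocolTree where
  k : ℕ
  parent : Fin (k + 1) → Option (Fin (k + 1))
  parent_root : parent (Fin.last k) = none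
  parent_lt : ∀ Q, Q ≠ Fin.last k → ∃ R, parent Q = some R ∧ Q < R
  /-- the main module of the sub-protocol -/
  M : Fin (k + 1) → Protocol
  /-- the ideal protocol associated with the sub-protocol -/
  I : Fin (k + 1) → Protocol

namespace ProtocolTree

variable (T : ProtocolTree)

/-- The nodes of the tree, that is, the sub-protocols. -/
abbrev Node : Type := Fin (T.k + 1)

/-- The root. -/
abbrev root : T.Node := Fin.last T.k

/-- The sub-protocols that are called by the main module of `Q`. -/
def children (Q : T.Node) : Finset T.Node := Finset.univ.filter fun R => T.parent R = some Q

theorem lt_of_mem_children {Q R : T.Node} (h : R ∈ T.children Q) : R < Q := by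
  have h1 : T.parent R = some Q := (Finset.mem_filter.1 h).2
  have h2 : R ≠ Fin.last T.k := by
    rintro rfl
    rw [T.parent_root] at h1
    cases h1
  obtain ⟨R', h3, h4⟩ := T.parent_lt R h2
  rw [h1] at h3
  cases h3
  exact h4

/-- The sub-protocol `Q = M(Q) + ∑ R ∈ C(Q), R`. -/
noncomputable def sub (Q : T.Node) : Protocol :=
  T.M Q + Protocol.sum (T.children Q).attach fun R => sub R.1
termination_by Q
decreasing_by exact T.lt_of_mem_children R.2

/-- The protocol `Q̃ = M(Q) + ∑ R ∈ C(Q), I(R)`. -/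
noncomputable def tilde (Q : T.Node) : Protocol :=
  T.M Q + Protocol.sum (T.children Q) T.I

/-- The names reserved for the whole tree. -/
def allNames : Set ℕ := ⋃ Q, (T.M Q).names

/-- The rules for the composition of modules. The modules have disjoint sets of reserved names, and
the names of an ideal protocol are reserved for its sub-protocol. A module only communicates, apart
from its internal channels, with its caller and with the modules that it calls: its input/output
channels are channels of the caller, or of the environment for the root. The corruption registers
belong to the environment. -/
structure WellFormed : Prop where
  module : ∀ Q, (T.M Q).WellFormed
  ideal : ∀ Q, (T.I Q).WellFormed
  disjoint : ∀ Q R, Q ≠ R → Disjoint (T.M Q).names (T.M R).names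
  ideal_names : ∀ Q, (T.I Q).names ⊆ (T.M Q).names
  names_left : T.allNamesᶜ.Infinite
  calls : ∀ Q R, T.parent Q = some R → ∀ r ∈ (T.M Q).roles, ∀ v ∈ (T.M Q).io r, v ∈ (T.M R).chan
  root_io : ∀ r ∈ (T.M T.root).roles, ∀ v ∈ (T.M T.root).io r, v.id ∉ T.allNames
  corr_names : ∀ Q, ∀ r ∈ (T.M Q).roles, ∀ c, r.corr = some c → c.id ∉ T.allNames ∧
    ∀ R, ∀ r' ∈ (T.M R).roles, c ∈ r'.regs → r'.corr = some c
  ideal_for : ∀ Q, IsIdealFor (T.tilde Q) (T.I Q)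

/-- The modules that are not yet replaced and the ideal protocols that are not yet replaced, outside
`Q̃`, when the traversal visits `Q`. -/
noncomputable def context (Q : T.Node) : Component :=
  Component.sum (Finset.univ.filter fun R => Q < R) (fun R => (T.M R).toComponent) +
  Component.sum (Finset.univ.filter fun R => R < Q ∧ ∃ R', T.parent R = some R' ∧ Q < R')
    (fun R => (T.I R).toComponent)

/-- The union of the simulators for the first `j` nodes of the traversal, for the environment `E` of
the whole protocol. The simulator of the node `Q` is the one that `σ Q` gives for `E(Q̃)`. -/
noncomputable def simulators (σ : T.Node → Env → Component) (E : Env) : ℕ → Component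
  | 0 => 0
  | j + 1 =>
    if h : j < T.k + 1 then
      simulators σ E j +
        σ ⟨j, h⟩ ⟨E.toComponent + T.context ⟨j, h⟩ + simulators σ E j, E.Z⟩
    else simulators σ E j

/-- The environment `E(Q̃)` of `Q̃` when the traversal visits `Q`: all that is present in the overall
setting at this point, except `Q̃`. -/
noncomputable def envAt (σ : T.Node → Env → Component) (E : Env) (Q : T.Node) : Env :=
  ⟨E.toComponent + T.context Q + T.simulators σ E Q, E.Z⟩

end ProtocolTree

/-!
The proof is a hybrid argument along the traversal of the tree. When `Q` is visited, the ideal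
protocols of its children are already in place, so that `Q̃` is present as a whole, and replacing
it by `I(Q)` and the simulator for `E(Q̃)` costs at most `ε_Q̃(E(Q̃))`. The sum of the differences
telescopes.

This step is possible because `E(Q̃)` is a valid environment for `Q̃`, by induction along the
traversal: each part of `E(Q̃)` only accesses what is reserved for `Q̃` as `Q̃` permits, since
distinct modules have disjoint names and only share the channels between a caller and the modules
it calls, and since a corrupted role of a module gives the same access to these channels as its
counterpart in the ideal protocol.
-/

namespace Component

attribute [ext] Component

@[simp] theorem mem_gates_add {A B : Component} {g : Gate} :
    g ∈ (A + B).gates ↔ g ∈ A.gates ∨ g ∈ B.gates := by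
  classical exact Finset.mem_union

@[simp] theorem rel_add {A B : Component} {x : Finset ℕ} {a b : ℕ} :
    (A + B).rel x a b ↔ A.rel x a b ∨ B.rel x a b := Iff.rfl

@[simp] theorem notMem_gates_zero {g : Gate} : g ∉ (0 : Component).gates :=
  Finset.notMem_empty g

@[simp] theorem not_rel_zero {x : Finset ℕ} {a b : ℕ} : ¬ (0 : Component).rel x a b := id

theorem ext_of_iff {A B : Component} (hg : ∀ g, g ∈ A.gates ↔ g ∈ B.gates)
    (hr : ∀ x a b, A.rel x a b ↔ B.rel x a b) : A = B :=
  Component.ext (Finset.ext hg) (by funext x a b; exact propext (hr x a b))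

noncomputable instance : AddCommMonoid Component where
  add_assoc A B C := ext_of_iff (by simp [or_assoc]) (by simp [or_assoc])
  zero_add A := ext_of_iff (by simp) (by simp)
  add_zero A := ext_of_iff (by simp) (by simp)
  add_comm A B := ext_of_iff (by simp [or_comm]) (by simp [or_comm])
  nsmul := nsmulRec

variable {ι : Type} {s : Finset ι} {F : ι → Component}

theorem sum_eq_finset_sum (s : Finset ι) (F : ι → Component) : sum s F = ∑ i ∈ s, F i := by
  induction s using Finset.cons_induction with
  | empty => exact ext_of_iff (by simp [sum]) (by simp [sum])
  | cons i s hi ih =>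
    rw [Finset.sum_cons, ← ih]
    exact ext_of_iff (by simp [sum]) (by simp [sum])

@[simp] theorem mem_gates_sum {g : Gate} :
    g ∈ (∑ i ∈ s, F i).gates ↔ ∃ i ∈ s, g ∈ (F i).gates := by
  classical
  rw [← sum_eq_finset_sum]
  exact Finset.mem_biUnion

@[simp] theorem rel_sum {x : Finset ℕ} {a b : ℕ} :
    (∑ i ∈ s, F i).rel x a b ↔ ∃ i ∈ s, (F i).rel x a b := by
  rw [← sum_eq_finset_sum, sum]

theorem mem_ids {A : Component} {a : ℕ} : a ∈ A.ids ↔ ∃ g ∈ A.gates, g.id = a :=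
  Finset.mem_image

theorem id_mem_ids {A : Component} {g : Gate} (hg : g ∈ A.gates) : g.id ∈ A.ids :=
  mem_ids.2 ⟨g, hg, rfl⟩

@[simp] theorem mem_ids_add {A B : Component} {a : ℕ} :
    a ∈ (A + B).ids ↔ a ∈ A.ids ∨ a ∈ B.ids := by
  simp only [mem_ids, mem_gates_add, or_and_right, exists_or]

@[simp] theorem mem_ids_sum {a : ℕ} : a ∈ (∑ i ∈ s, F i).ids ↔ ∃ i ∈ s, a ∈ (F i).ids := by
  simp only [mem_ids, mem_gates_sum]
  grind

end Component

namespace Protocol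

attribute [ext] Protocol

@[simp] theorem mem_roles_add {P Q : Protocol} {r : Role} :
    r ∈ (P + Q).roles ↔ r ∈ P.roles ∨ r ∈ Q.roles := by
  classical exact Finset.mem_union

@[simp] theorem names_add (P Q : Protocol) : (P + Q).names = P.names ∪ Q.names := rfl

@[simp] theorem chan_add (P Q : Protocol) : (P + Q).chan = P.chan ∪ Q.chan := rfl

@[simp] theorem readable_add (P Q : Protocol) :
    (P + Q).readable = P.readable ∪ Q.readable := rfl

@[simp] theorem writable_add (P Q : Protocol) :
    (P + Q).writable = P.writable ∪ Q.writable := rfl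

instance : Zero Protocol := ⟨⟨∅, ∅, ∅, ∅, ∅⟩⟩

theorem zero_def : (0 : Protocol) = ⟨∅, ∅, ∅, ∅, ∅⟩ := rfl

noncomputable instance : AddCommMonoid Protocol where
  add_assoc P Q R := by ext <;> simp [or_assoc]
  zero_add P := by ext <;> simp [zero_def]
  add_zero P := by ext <;> simp [zero_def]
  add_comm P Q := by ext <;> simp [or_comm]
  nsmul := nsmulRec

variable {ι : Type} {s : Finset ι} {F : ι → Protocol}

theorem sum_eq_finset_sum (s : Finset ι) (F : ι → Protocol) : sum s F = ∑ i ∈ s, F i := by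
  induction s using Finset.cons_induction with
  | empty => ext <;> simp [sum, zero_def]
  | cons i s hi ih => rw [Finset.sum_cons, ← ih]; ext <;> simp [sum]

@[simp] theorem mem_roles_sum {r : Role} :
    r ∈ (∑ i ∈ s, F i).roles ↔ ∃ i ∈ s, r ∈ (F i).roles := by
  classical
  rw [← sum_eq_finset_sum]
  exact Finset.mem_biUnion

@[simp] theorem names_sum : (∑ i ∈ s, F i).names = ⋃ i ∈ s, (F i).names := by
  rw [← sum_eq_finset_sum, sum]

@[simp] theorem readable_sum : (∑ i ∈ s, F i).readable = ⋃ i ∈ s, (F i).readable := by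
  rw [← sum_eq_finset_sum, sum]

@[simp] theorem writable_sum : (∑ i ∈ s, F i).writable = ⋃ i ∈ s, (F i).writable := by
  rw [← sum_eq_finset_sum, sum]

@[simp] theorem mem_gates_toComponent {P : Protocol} {g : Gate} :
    g ∈ P.toComponent.gates ↔ ∃ r ∈ P.roles, g ∈ r.gates := by
  classical exact Finset.mem_biUnion

@[simp] theorem rel_toComponent {P : Protocol} {x : Finset ℕ} {a b : ℕ} :
    P.toComponent.rel x a b ↔ ∃ r ∈ P.roles, r.rel x a b := Iff.rfl

@[simp] theorem toComponent_add (P Q : Protocol) :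
    (P + Q).toComponent = P.toComponent + Q.toComponent :=
  Component.ext_of_iff (by simp [or_and_right, exists_or]) (by simp [or_and_right, exists_or])

@[simp] theorem toComponent_sum :
    (∑ i ∈ s, F i).toComponent = ∑ i ∈ s, (F i).toComponent := by
  refine Component.ext_of_iff (fun g => ?_) fun x a b => ?_ <;> simp <;> grind

@[simp] theorem permits_add {P Q : Protocol} {g : Gate} {v : Reg} :
    (P + Q).Permits g v ↔ P.Permits g v ∨ Q.Permits g v := by
  simp only [Permits, writable_add, readable_add, mem_roles_add, Set.mem_union]
  grind

@[simp] theorem permits_sum {g : Gate} {v : Reg} :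
    (∑ i ∈ s, F i).Permits g v ↔ ∃ i ∈ s, (F i).Permits g v := by
  simp only [Permits, writable_sum, readable_sum, mem_roles_sum, Set.mem_iUnion, exists_prop]
  grind

/-- The corruption registers of the roles of a protocol. -/
def corrRegs (P : Protocol) : Set Reg := {v | ∃ r ∈ P.roles, r.corr = some v}

/-- The input/output channel registers of the roles of a protocol. -/
def ioRegs (P : Protocol) : Set Reg := {v | ∃ r ∈ P.roles, v ∈ P.io r}

/-- The registers that a protocol can use or give access to: those with a reserved name, the
corruption registers and the input/output channels. -/
def scope (P : Protocol) : Set Reg := {v | v.id ∈ P.names} ∪ P.corrRegs ∪ P.ioRegs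

@[simp] theorem corrRegs_add (P Q : Protocol) : (P + Q).corrRegs = P.corrRegs ∪ Q.corrRegs := by
  ext v
  simp [corrRegs, or_and_right, exists_or]

@[simp] theorem corrRegs_sum : (∑ i ∈ s, F i).corrRegs = ⋃ i ∈ s, (F i).corrRegs := by
  ext v
  simp only [corrRegs, mem_roles_sum, Set.mem_iUnion, Set.mem_ofPred_eq]
  grind

theorem mem_names_or_corr_or_io {P : Protocol} {r : Role} {v : Reg} (hv : v ∈ r.regs) :
    v.id ∈ P.names ∨ r.corr = some v ∨ v ∈ P.io r := by
  by_cases hn : v.id ∈ P.names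
  · exact .inl hn
  by_cases hc : r.corr = some v
  · exact .inr (.inl hc)
  · exact .inr (.inr ⟨hv, hn, hc⟩)

theorem mem_scope_of_mem_regs {P : Protocol} {r : Role} {v : Reg} (hr : r ∈ P.roles)
    (hv : v ∈ r.regs) : v ∈ P.scope := by
  rcases mem_names_or_corr_or_io (P := P) hv with hn | hc | hio
  exacts [.inl (.inl hn), .inl (.inr ⟨r, hr, hc⟩), .inr ⟨r, hr, hio⟩]

namespace WellFormed

variable {P : Protocol} (hP : P.WellFormed)
include hP

theorem ids_subset_names {a : ℕ} (ha : a ∈ P.toComponent.ids) : a ∈ P.names := by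
  obtain ⟨g, hg, rfl⟩ := Component.mem_ids.1 ha
  obtain ⟨r, hr, hgr⟩ := mem_gates_toComponent.1 hg
  exact ((hP.role_circuit r hr).2.1 g hgr).1

theorem exists_role_of_mem_regs {g : Gate} {v : Reg} (hg : g ∈ P.toComponent.gates)
    (hv : v ∈ g.regs) : ∃ r ∈ P.roles, v ∈ r.regs := by
  obtain ⟨r, hr, hgr⟩ := mem_gates_toComponent.1 hg
  exact ⟨r, hr, ((hP.role_circuit r hr).2.1 g hgr).2 hv⟩

theorem mem_ids_of_rel {x : Finset ℕ} {a b d : ℕ} (hab : P.toComponent.rel x a b)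
    (hd : d = a ∨ d = b) : d ∈ P.toComponent.ids := by
  obtain ⟨r, hr, hrel⟩ := rel_toComponent.1 hab
  have hids := (hP.role_circuit r hr).2.2 x a b hrel
  obtain ⟨g, hg, rfl⟩ := Component.mem_ids.1 (show d ∈ r.ids by grind)
  exact Component.id_mem_ids (mem_gates_toComponent.2 ⟨r, hr, hg⟩)

theorem mem_chan_or_corrupted_of_permits {g : Gate} {v : Reg} (h : P.Permits g v) :
    v ∈ P.chan ∨ ∃ r ∈ P.roles, ∃ c, r.corr = some c ∧ (c, 1) ∈ g.ctrl ∧ v ∈ r.regs := by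
  rcases h with hw | ⟨hr, -⟩ | hcorrupted
  exacts [.inl (hP.types.2.1 hw), .inl (hP.types.1 hr), .inr hcorrupted]

theorem mem_scope_of_permits {g : Gate} {v : Reg} (h : P.Permits g v) : v ∈ P.scope := by
  rcases hP.mem_chan_or_corrupted_of_permits h with hch | ⟨r, hr, c, -, -, hv⟩
  exacts [.inl (.inl (hP.chan_names v hch)), mem_scope_of_mem_regs hr hv]

end WellFormed

end Protocol

namespace ProtocolTree

variable {T : ProtocolTree}

/-! ### Traversals of a tree -/

theorem mem_children {Q R : T.Node} : R ∈ T.children Q ↔ T.parent R = some Q := by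
  simp [children]

theorem lt_of_parent_eq {Q R : T.Node} (h : T.parent R = some Q) : R < Q :=
  T.lt_of_mem_children (mem_children.2 h)

theorem exists_parent_of_lt {Q R : T.Node} (h : Q < R) : ∃ R', T.parent Q = some R' ∧ Q < R' :=
  T.parent_lt Q (h.trans_le (Fin.le_last R)).ne

variable (T) in
/-- The roots of the maximal subtrees among the first `j` nodes of the traversal. -/
def frontier (j : ℕ) : Finset T.Node :=
  Finset.univ.filter fun R => R < j ∧ ∀ R', T.parent R = some R' → j ≤ R'

variable (T) in
/-- The nodes of the frontier that are not called by the node `Q` when the traversal visits it. -/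
def pending (Q : T.Node) : Finset T.Node :=
  Finset.univ.filter fun R => R < Q ∧ ∃ R', T.parent R = some R' ∧ Q < R'

theorem mem_frontier {j : ℕ} {R : T.Node} :
    R ∈ T.frontier j ↔ R < j ∧ ∀ R', T.parent R = some R' → j ≤ R' := by
  simp [frontier]

theorem mem_pending {Q R : T.Node} :
    R ∈ T.pending Q ↔ R < Q ∧ ∃ R', T.parent R = some R' ∧ Q < R' := by
  simp [pending]

theorem frontier_zero : T.frontier 0 = ∅ := by simp [frontier]

theorem frontier_card : T.frontier (T.k + 1) = {T.root} := by
  ext R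
  have hR := T.parent_lt R
  have hroot := T.parent_root
  rw [mem_frontier, Finset.mem_singleton]
  grind

theorem frontier_val (Q : T.Node) : T.frontier Q = T.pending Q ∪ T.children Q := by
  ext R
  have hR := exists_parent_of_lt (Q := R) (R := Q)
  have hQ := lt_of_parent_eq (R := R) (Q := Q)
  rw [Finset.mem_union, mem_frontier, mem_pending, mem_children]
  grind

theorem disjoint_pending_children (Q : T.Node) : Disjoint (T.pending Q) (T.children Q) := by
  simp only [Finset.disjoint_left, mem_pending, mem_children]
  grind

theorem notMem_pending_self (Q : T.Node) : Q ∉ T.pending Q := by simp [pending]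

theorem frontier_succ (Q : T.Node) :
    T.frontier (Q + 1) = Finset.cons Q (T.pending Q) (notMem_pending_self Q) := by
  ext R
  have hR := exists_parent_of_lt (Q := R) (R := Q)
  have hQ : ∀ R', T.parent Q = some R' → Q < R' := fun _ => lt_of_parent_eq
  rw [Finset.mem_cons, mem_frontier, mem_pending]
  grind

section Stage

variable {A : Type*} [AddCommMonoid A] (f g : T.Node → A)

/-- The sum of `g` over the maximal subtrees among the first `j` nodes of the traversal, and of `f`
over the remaining nodes. -/
def stage (j : ℕ) : A :=
  ∑ R ∈ Finset.univ.filter (fun R : T.Node => j ≤ R), f R + ∑ R ∈ T.frontier j, g R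

/-- The part that `stage f g Q` and `stage f g (Q + 1)` have in common. -/
def stageContext (Q : T.Node) : A :=
  ∑ R ∈ Finset.univ.filter (fun R : T.Node => Q < R), f R + ∑ R ∈ T.pending Q, g R

theorem stage_zero : stage f g 0 = ∑ R, f R := by simp [stage, frontier_zero]

theorem stage_card : stage f g (T.k + 1) = g T.root := by
  have hlate : (Finset.univ.filter fun R : T.Node => T.k + 1 ≤ R) = ∅ :=
    Finset.filter_false_of_mem fun R _ => R.isLt.not_ge
  rw [stage, hlate, frontier_card, Finset.sum_empty, zero_add, Finset.sum_singleton]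

theorem stage_val (Q : T.Node) :
    stage f g Q = stageContext f g Q + (f Q + ∑ R ∈ T.children Q, g R) := by
  have hQ : (Finset.univ.filter fun R : T.Node => (Q : ℕ) ≤ R) =
      Finset.cons Q (Finset.univ.filter fun R => Q < R) (by simp) := by
    ext R
    simp [le_iff_eq_or_lt, Fin.ext_iff, eq_comm]
  rw [stage, stageContext, hQ, Finset.sum_cons, frontier_val,
    Finset.sum_union (disjoint_pending_children Q)]
  abel

theorem stage_succ (Q : T.Node) : stage f g (Q + 1) = stageContext f g Q + g Q := by
  simp only [stage, stageContext, frontier_succ, Finset.sum_cons, Nat.succ_le_iff, Fin.lt_def]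
  abel

theorem sum_eq_root (hg : ∀ Q, g Q = f Q + ∑ R ∈ T.children Q, g R) :
    g T.root = ∑ R, f R := by
  have hstage : ∀ j ≤ T.k + 1, stage f g j = stage f g 0 := by
    intro j hj
    induction j with
    | zero => rfl
    | succ j ih =>
      rw [← ih (by omega)]
      let Q : T.Node := ⟨j, hj⟩
      exact (stage_succ f g Q).trans (by rw [stage_val f g Q, ← hg])
  rw [← stage_card f g, hstage _ le_rfl, stage_zero]

end Stage

/-! ### The sub-protocols of a tree -/

theorem sub_root_eq_sum : T.sub T.root = ∑ Q, T.M Q := by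
  refine sum_eq_root T.M T.sub fun Q => ?_
  rw [sub, Protocol.sum_eq_finset_sum, Finset.sum_attach _ fun R => T.sub R]

theorem names_sub_root : (T.sub T.root).names = T.allNames := by
  simp [sub_root_eq_sum, allNames]

theorem mem_roles_sub_root {r : Role} :
    r ∈ (T.sub T.root).roles ↔ ∃ Q, r ∈ (T.M Q).roles := by
  simp [sub_root_eq_sum]

theorem mem_corrRegs_sub_root {v : Reg} :
    v ∈ (T.sub T.root).corrRegs ↔ ∃ Q, v ∈ (T.M Q).corrRegs := by
  simp [sub_root_eq_sum]

theorem permits_sub_root {g : Gate} {v : Reg} :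
    (T.sub T.root).Permits g v ↔ ∃ Q, (T.M Q).Permits g v := by
  simp [sub_root_eq_sum]

theorem tilde_eq_add_sum (Q : T.Node) :
    T.tilde Q = T.M Q + ∑ R ∈ T.children Q, T.I R := by
  rw [tilde, Protocol.sum_eq_finset_sum]

theorem mem_roles_tilde {Q : T.Node} {r : Role} :
    r ∈ (T.tilde Q).roles ↔
      r ∈ (T.M Q).roles ∨ ∃ R, T.parent R = some Q ∧ r ∈ (T.I R).roles := by
  simp [tilde_eq_add_sum, mem_children]

theorem mem_names_tilde {Q : T.Node} {a : ℕ} :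
    a ∈ (T.tilde Q).names ↔
      a ∈ (T.M Q).names ∨ ∃ R, T.parent R = some Q ∧ a ∈ (T.I R).names := by
  simp [tilde_eq_add_sum, mem_children]

theorem mem_corrRegs_tilde {Q : T.Node} {v : Reg} :
    v ∈ (T.tilde Q).corrRegs ↔
      v ∈ (T.M Q).corrRegs ∨ ∃ R, T.parent R = some Q ∧ v ∈ (T.I R).corrRegs := by
  simp [tilde_eq_add_sum, mem_children]

theorem permits_tilde {Q : T.Node} {g : Gate} {v : Reg} :
    (T.tilde Q).Permits g v ↔
      (T.M Q).Permits g v ∨ ∃ R, T.parent R = some Q ∧ (T.I R).Permits g v := by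
  simp [tilde_eq_add_sum, mem_children]

theorem mem_ids_tilde {Q : T.Node} {a : ℕ} :
    a ∈ (T.tilde Q).toComponent.ids ↔ a ∈ (T.M Q).toComponent.ids ∨
      ∃ R, T.parent R = some Q ∧ a ∈ (T.I R).toComponent.ids := by
  simp [tilde_eq_add_sum, mem_children]

theorem names_subset_allNames (Q : T.Node) : (T.M Q).names ⊆ T.allNames :=
  Set.subset_iUnion (fun Q => (T.M Q).names) Q

/-! ### Names and registers in a well-formed tree -/

namespace WellFormed

variable (hT : T.WellFormed)
include hT

theorem eq_of_mem_names {Q R : T.Node} {a : ℕ} (hQ : a ∈ (T.M Q).names)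
    (hR : a ∈ (T.M R).names) : Q = R := by
  by_contra hne
  exact Set.disjoint_left.1 (hT.disjoint Q R hne) hQ hR

theorem mem_names_tilde_iff {Q R : T.Node} {a : ℕ} (ha : a ∈ (T.M R).names) :
    a ∈ (T.tilde Q).names ↔ R = Q ∨ T.parent R = some Q ∧ a ∈ (T.I R).names := by
  rw [mem_names_tilde]
  constructor
  · rintro (hQ | ⟨S, hS, hI⟩)
    · exact .inl (hT.eq_of_mem_names ha hQ)
    · obtain rfl := hT.eq_of_mem_names ha (hT.ideal_names S hI)
      exact .inr ⟨hS, hI⟩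
  · rintro (rfl | hR)
    exacts [.inl ha, .inr ⟨R, hR⟩]

theorem names_tilde_subset (Q : T.Node) : (T.tilde Q).names ⊆ T.allNames := by
  intro a ha
  rcases mem_names_tilde.1 ha with h | ⟨R, -, h⟩
  exacts [names_subset_allNames Q h, names_subset_allNames R (hT.ideal_names R h)]

theorem names_ideal_subset (Q : T.Node) : (T.I Q).names ⊆ T.allNames :=
  (hT.ideal_names Q).trans (names_subset_allNames Q)

theorem notMem_names_tilde_of_lt {Q R : T.Node} {a : ℕ} (hlt : Q < R)
    (ha : a ∈ (T.M R).names) : a ∉ (T.tilde Q).names := by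
  rw [hT.mem_names_tilde_iff ha]
  rintro (rfl | ⟨hR, -⟩)
  exacts [hlt.false, hlt.asymm (lt_of_parent_eq hR)]

theorem parent_eq_of_mem_names_ideal {Q R : T.Node} {a : ℕ} (hlt : R < Q)
    (ha : a ∈ (T.I R).names) (hQ : a ∈ (T.tilde Q).names) : T.parent R = some Q :=
  (((hT.mem_names_tilde_iff (hT.ideal_names R ha)).1 hQ).resolve_left hlt.ne).1

/-- The set difference consists of the names available to a simulator for `R̃`. -/
theorem disjoint_names_tilde {Q R : T.Node} (hlt : R < Q) :
    Disjoint ((T.tilde R).names \ (T.I R).names) (T.tilde Q).names := by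
  rw [Set.disjoint_left]
  rintro a ⟨hR, hIR⟩ hQ
  rcases mem_names_tilde.1 hR with ha | ⟨S, hS, ha⟩
  · rcases (hT.mem_names_tilde_iff ha).1 hQ with rfl | ⟨-, hI⟩
    exacts [hlt.false, hIR hI]
  · have hSQ := hT.parent_eq_of_mem_names_ideal ((lt_of_parent_eq hS).trans hlt) ha hQ
    exact hlt.ne (Option.some_injective _ (hS.symm.trans hSQ))

theorem corrRegs_ideal_subset (R : T.Node) :
    (T.I R).corrRegs ⊆ (T.sub T.root).corrRegs := by
  induction R using WellFoundedLT.induction with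
  | ind R ih =>
    rintro c ⟨r, hr, hc⟩
    rcases mem_corrRegs_tilde.1 ((hT.ideal_for R).corr r hr c hc) with h | ⟨S, hS, h⟩
    exacts [mem_corrRegs_sub_root.2 ⟨R, h⟩, ih S (lt_of_parent_eq hS) h]

theorem corrRegs_tilde_subset (R : T.Node) :
    (T.tilde R).corrRegs ⊆ (T.sub T.root).corrRegs := by
  intro c hc
  rcases mem_corrRegs_tilde.1 hc with h | ⟨S, -, h⟩
  exacts [mem_corrRegs_sub_root.2 ⟨R, h⟩, hT.corrRegs_ideal_subset S h]

theorem notMem_allNames_of_mem_corrRegs {c : Reg} (hc : c ∈ (T.sub T.root).corrRegs) :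
    c.id ∉ T.allNames := by
  obtain ⟨Q, r, hr, hrc⟩ := mem_corrRegs_sub_root.1 hc
  exact (hT.corr_names Q r hr c hrc).1

theorem notMem_ioRegs_of_mem_corrRegs {R : T.Node} {c : Reg}
    (hc : c ∈ (T.sub T.root).corrRegs) : c ∉ (T.M R).ioRegs := by
  obtain ⟨Q, r, hr, hrc⟩ := mem_corrRegs_sub_root.1 hc
  rintro ⟨r', hr', hcr', -, hne⟩
  exact hne ((hT.corr_names Q r hr c hrc).2 R r' hr' hcr')

theorem ioRegs_subset_chan {Q R : T.Node} (hR : T.parent R = some Q) :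
    (T.M R).ioRegs ⊆ (T.M Q).chan := by
  rintro v ⟨r, hr, hv⟩
  exact hT.calls R Q hR r hr v hv

theorem ioRegs_ideal_subset (R : T.Node) : (T.I R).ioRegs ⊆ (T.M R).ioRegs := by
  induction R using WellFoundedLT.induction with
  | ind R ih =>
    rintro v ⟨r, hr, hv⟩
    obtain ⟨r', hr', -, hv', hn, hne⟩ := (hT.ideal_for R).io_of_ideal r hr v hv
    have hnM : v.id ∉ (T.M R).names := fun h => hn (mem_names_tilde.2 (.inl h))
    rcases mem_roles_tilde.1 hr' with h | ⟨S, hS, h⟩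
    · exact ⟨r', h, hv', hnM, hne⟩
    · have hnS : v.id ∉ (T.I S).names := fun h => hn (mem_names_tilde.2 (.inr ⟨S, hS, h⟩))
      have hio := ih S (lt_of_parent_eq hS) ⟨r', h, hv', hnS, hne⟩
      exact absurd ((hT.module R).chan_names v (hT.ioRegs_subset_chan hS hio)) hnM

theorem notMem_names_tilde_of_io {R : T.Node} {v : Reg} (hv : v ∈ (T.M R).ioRegs) :
    v.id ∉ (T.tilde R).names := by
  by_cases hR : R = T.root
  · subst hR
    obtain ⟨r, hr, hv⟩ := hv
    exact fun h => hT.root_io r hr v hv (hT.names_tilde_subset _ h)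
  · obtain ⟨Q, hQ, hlt⟩ := T.parent_lt R hR
    exact hT.notMem_names_tilde_of_lt hlt
      ((hT.module Q).chan_names v (hT.ioRegs_subset_chan hQ hv))

theorem exists_ideal_role_of_io {R : T.Node} {r : Role} {v : Reg} (hr : r ∈ (T.M R).roles)
    (hv : v ∈ (T.M R).io r) : ∃ r' ∈ (T.I R).roles, r'.corr = r.corr ∧ v ∈ (T.I R).io r' :=
  (hT.ideal_for R).io_of_real r (mem_roles_tilde.2 (.inl hr)) v
    ⟨hv.1, hT.notMem_names_tilde_of_io ⟨r, hr, hv⟩, hv.2.2⟩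

theorem eq_of_mem_chan {Q R : T.Node} {v : Reg} (hv : v ∈ (T.M R).chan)
    (hQ : v.id ∈ (T.tilde Q).names) : R = Q := by
  refine ((hT.mem_names_tilde_iff ((hT.module R).chan_names v hv)).1 hQ).resolve_right ?_
  exact fun h => (hT.ideal_for R).chan_names v (.inl hv) h.2

theorem eq_or_io_of_mem_regs {Q R : T.Node} {r : Role} {v : Reg} (hr : r ∈ (T.M R).roles)
    (hv : v ∈ r.regs) (hQ : v.id ∈ (T.tilde Q).names) :
    R = Q ∨ T.parent R = some Q ∧ v ∈ (T.M R).io r := by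
  rcases Protocol.mem_names_or_corr_or_io (P := T.M R) hv with hn | hc | hio
  · refine ((hT.mem_names_tilde_iff hn).1 hQ).imp_right fun h => ?_
    exact absurd h.2 ((hT.ideal_for R).reg_names r (mem_roles_tilde.2 (.inl hr)) v hv)
  · exact absurd (hT.names_tilde_subset Q hQ) (hT.corr_names R r hr v hc).1
  · by_cases hR : R = T.root
    · subst hR
      exact absurd (hT.names_tilde_subset Q hQ) (hT.root_io r hr v hio)
    · obtain ⟨R', hR', -⟩ := T.parent_lt R hR
      obtain rfl := hT.eq_of_mem_chan (hT.ioRegs_subset_chan hR' ⟨r, hr, hio⟩) hQ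
      exact .inr ⟨hR', hio⟩

theorem parent_eq_of_mem_scope_ideal {Q R : T.Node} {v : Reg} (hlt : R < Q)
    (hv : v ∈ (T.I R).scope) (hQ : v.id ∈ (T.tilde Q).names) : T.parent R = some Q := by
  rcases hv with (hn | hc) | hio
  · exact hT.parent_eq_of_mem_names_ideal hlt hn hQ
  · exact absurd (hT.names_tilde_subset Q hQ)
      (hT.notMem_allNames_of_mem_corrRegs (hT.corrRegs_ideal_subset R hc))
  · obtain ⟨r, hr, hio⟩ := hT.ioRegs_ideal_subset R hio
    exact ((hT.eq_or_io_of_mem_regs hr hio.1 hQ).resolve_left hlt.ne).1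

theorem exists_module_role_of_mem_scope_ideal {R : T.Node} {v : Reg}
    (hv : v ∈ (T.I R).scope) (hn : v.id ∉ T.allNames) :
    ∃ Q, ∃ r ∈ (T.M Q).roles, v ∈ r.regs := by
  rcases hv with (h | hc) | hio
  · exact absurd (hT.names_ideal_subset R h) hn
  · obtain ⟨Q, r, hr, hrc⟩ := mem_corrRegs_sub_root.1 (hT.corrRegs_ideal_subset R hc)
    exact ⟨Q, r, hr, ((hT.module Q).corruptible r hr v hrc).2.1⟩
  · obtain ⟨r, hr, hio⟩ := hT.ioRegs_ideal_subset R hio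
    exact ⟨R, r, hr, hio.1⟩

theorem mem_ids_tilde_of_module {Q R : T.Node} {a : ℕ} (ha : a ∈ (T.M R).toComponent.ids)
    (hQ : a ∈ (T.tilde Q).names) : a ∈ (T.tilde Q).toComponent.ids := by
  rcases (hT.mem_names_tilde_iff ((hT.module R).ids_subset_names ha)).1 hQ with rfl | ⟨hR, hI⟩
  · exact mem_ids_tilde.2 (.inl ha)
  · exact mem_ids_tilde.2 (.inr ⟨R, hR,
      (hT.ideal_for R).gate_names a (mem_ids_tilde.2 (.inl ha)) hI⟩)

theorem mem_ids_tilde_of_ideal {Q R : T.Node} {a : ℕ} (hlt : R < Q)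
    (ha : a ∈ (T.I R).toComponent.ids) (hQ : a ∈ (T.tilde Q).names) :
    a ∈ (T.tilde Q).toComponent.ids :=
  mem_ids_tilde.2 (.inr ⟨R,
    hT.parent_eq_of_mem_names_ideal hlt ((hT.ideal R).ids_subset_names ha) hQ, ha⟩)

theorem permits_tilde_of_module {Q R : T.Node} {g : Gate} {v : Reg}
    (h : (T.M R).Permits g v) (hQ : v.id ∈ (T.tilde Q).names) : (T.tilde Q).Permits g v := by
  rcases (hT.module R).mem_chan_or_corrupted_of_permits h with hch | ⟨r, hr, c, hc, hctrl, hv⟩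
  · obtain rfl := hT.eq_of_mem_chan hch hQ
    exact permits_tilde.2 (.inl h)
  · rcases hT.eq_or_io_of_mem_regs hr hv hQ with rfl | ⟨hR, hio⟩
    · exact permits_tilde.2 (.inl h)
    · obtain ⟨r', hr', hcorr, hio'⟩ := hT.exists_ideal_role_of_io hr hio
      exact permits_tilde.2 (.inr ⟨R, hR,
        .inr (.inr ⟨r', hr', c, hcorr.trans hc, hctrl, hio'.1⟩)⟩)

theorem permits_tilde_of_ideal {Q R : T.Node} {g : Gate} {v : Reg} (hlt : R < Q)
    (h : (T.I R).Permits g v) (hQ : v.id ∈ (T.tilde Q).names) : (T.tilde Q).Permits g v :=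
  permits_tilde.2 (.inr ⟨R,
    hT.parent_eq_of_mem_scope_ideal hlt ((hT.ideal R).mem_scope_of_permits h) hQ, h⟩)

end WellFormed

end ProtocolTree

/-! ### Components that respect a protocol -/

/-- The conditions on a valid environment for `P` that concern its gates and its order relations one
by one: in contrast to the other conditions, they pass to unions of components. -/
structure Component.Respects (A : Component) (P : Protocol) : Prop where
  own_gates : ∀ g ∈ A.gates, g.id ∉ P.names
  permitted : ∀ g ∈ A.gates, ∀ v ∈ g.regs, v.id ∈ P.names → P.Permits g v
  order : ∀ x a b, A.rel x a b → ∀ d, d = a ∨ d = b → d ∈ P.names → d ∈ P.toComponent.ids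

namespace Component.Respects

variable {A B : Component} {P : Protocol}

theorem zero : Respects 0 P where
  own_gates _ hg := absurd hg notMem_gates_zero
  permitted _ hg := absurd hg notMem_gates_zero
  order _ _ _ hab := absurd hab not_rel_zero

theorem add (hA : A.Respects P) (hB : B.Respects P) : (A + B).Respects P where
  own_gates g hg := (mem_gates_add.1 hg).elim (hA.own_gates g) (hB.own_gates g)
  permitted g hg := (mem_gates_add.1 hg).elim (hA.permitted g) (hB.permitted g)
  order x a b hab := (rel_add.1 hab).elim (hA.order x a b) (hB.order x a b)

theorem sum {ι : Type} {s : Finset ι} {F : ι → Component} (h : ∀ i ∈ s, (F i).Respects P) :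
    (∑ i ∈ s, F i).Respects P :=
  Finset.sum_induction F (·.Respects P) (fun _ _ => add) zero h

end Component.Respects

theorem ValidEnv.respects {P : Protocol} {E : Env} (hE : ValidEnv P E) :
    E.toComponent.Respects P where
  own_gates := hE.own_gates
  permitted := hE.permitted
  order x a b hab d hd hn := by
    rcases hd with rfl | rfl
    exacts [(hE.order x d b hab).1 hn, (hE.order x a d hab).2 hn]

namespace ProtocolTree

variable {T : ProtocolTree}

namespace WellFormed

variable (hT : T.WellFormed)
include hT

theorem respects_tilde {A : Component} (hA : A.Respects (T.sub T.root)) (Q : T.Node) :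
    A.Respects (T.tilde Q) where
  own_gates g hg hn := hA.own_gates g hg (names_sub_root ▸ hT.names_tilde_subset Q hn)
  permitted g hg v hv hn := by
    obtain ⟨R, hR⟩ := permits_sub_root.1
      (hA.permitted g hg v hv (names_sub_root ▸ hT.names_tilde_subset Q hn))
    exact hT.permits_tilde_of_module hR hn
  order x a b hab d hd hn := by
    have hids := hA.order x a b hab d hd (names_sub_root ▸ hT.names_tilde_subset Q hn)
    simp only [sub_root_eq_sum, Protocol.toComponent_sum, Component.mem_ids_sum] at hids
    obtain ⟨R, -, hR⟩ := hids
    exact hT.mem_ids_tilde_of_module hR hn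

theorem module_respects_tilde {Q R : T.Node} (hlt : Q < R) :
    (T.M R).toComponent.Respects (T.tilde Q) where
  own_gates g hg := hT.notMem_names_tilde_of_lt hlt
    ((hT.module R).ids_subset_names (Component.id_mem_ids hg))
  permitted g hg v hv hn := by
    obtain ⟨r, hr, hvr⟩ := (hT.module R).exists_role_of_mem_regs hg hv
    rcases hT.eq_or_io_of_mem_regs hr hvr hn with rfl | ⟨hR, -⟩
    exacts [absurd hlt (lt_irrefl _), absurd (lt_of_parent_eq hR) hlt.asymm]
  order x a b hab d hd := hT.mem_ids_tilde_of_module ((hT.module R).mem_ids_of_rel hab hd)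

theorem ideal_respects_tilde {Q R : T.Node} (hR : R ∈ T.pending Q) :
    (T.I R).toComponent.Respects (T.tilde Q) := by
  obtain ⟨hlt, R', hR', hQR'⟩ := mem_pending.1 hR
  have hnot : T.parent R ≠ some Q := fun h => hQR'.ne (Option.some_injective _ (h.symm.trans hR'))
  refine ⟨fun g hg hn => hnot ?_, fun g hg v hv hn => absurd ?_ hnot, fun x a b hab d hd => ?_⟩
  · exact hT.parent_eq_of_mem_names_ideal hlt
      ((hT.ideal R).ids_subset_names (Component.id_mem_ids hg)) hn
  · obtain ⟨r, hr, hvr⟩ := (hT.ideal R).exists_role_of_mem_regs hg hv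
    exact hT.parent_eq_of_mem_scope_ideal hlt (Protocol.mem_scope_of_mem_regs hr hvr) hn
  · exact hT.mem_ids_tilde_of_ideal hlt ((hT.ideal R).mem_ids_of_rel hab hd)

theorem mem_corrRegs_sub_root_of_tilde_or_ideal {R : T.Node} {c : Reg}
    (hc : ∃ r, (r ∈ (T.tilde R).roles ∨ r ∈ (T.I R).roles) ∧ r.corr = some c) :
    c ∈ (T.sub T.root).corrRegs := by
  obtain ⟨r, hr | hr, hrc⟩ := hc
  exacts [hT.corrRegs_tilde_subset R ⟨r, hr, hrc⟩, hT.corrRegs_ideal_subset R ⟨r, hr, hrc⟩]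

theorem respects_tilde_of_validSim {Q R : T.Node} {F : Env} {S : Component} (hlt : R < Q)
    (hS : ValidSim (T.tilde R) (T.I R) F S)
    (hF : ∀ a ∈ F.ids, a ∈ (T.tilde Q).names → a ∈ (T.tilde Q).toComponent.ids) :
    S.Respects (T.tilde Q) := by
  have hown : ∀ a, a ∈ (T.tilde R).names ∧ a ∉ (T.I R).names → a ∉ (T.tilde Q).names :=
    fun _ ha => Set.disjoint_left.1 (hT.disjoint_names_tilde hlt) ha
  refine ⟨fun g hg => hown _ (hS.own_gates g hg), fun g hg v hv hn => ?_,
    fun x a b hab d hd hn => ?_⟩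
  · rcases hS.permitted g hg v hv with hown' | ⟨hc, -⟩ | ⟨-, hP⟩
    · exact absurd hn (hown _ hown')
    · exact absurd (hT.names_tilde_subset Q hn) (hT.notMem_allNames_of_mem_corrRegs
        (hT.mem_corrRegs_sub_root_of_tilde_or_ideal hc))
    · exact hT.permits_tilde_of_ideal hlt hP hn
  · obtain ⟨hSEP, hI⟩ := hS.order x a b hab d hd
    rcases hSEP with hids | hids | hnR
    · obtain ⟨g, hg, rfl⟩ := Component.mem_ids.1 hids
      exact absurd hn (hown _ (hS.own_gates g hg))
    · exact hF d hids hn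
    · by_cases hdI : d ∈ (T.I R).names
      exacts [hT.mem_ids_tilde_of_ideal hlt (hI hdI) hn, absurd hn (hown d ⟨hnR, hdI⟩)]

theorem names_tilde_diff_subset (R : T.Node) :
    (T.tilde R).names \ (T.I R).names ⊆ T.allNames \ (T.I T.root).names := by
  refine fun a ha => ⟨hT.names_tilde_subset R ha.1, fun hroot => ?_⟩
  rcases (Fin.le_last R).eq_or_lt with rfl | hlt
  · exact ha.2 hroot
  · exact Set.disjoint_left.1 (hT.disjoint_names_tilde hlt) ha
      (mem_names_tilde.2 (.inl (hT.ideal_names _ hroot)))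

theorem mem_allNames_diff_of_mem_scope_ideal {R : T.Node} {v : Reg} (hlt : R < T.root)
    (hv : v ∈ (T.I R).scope) (hc : v ∉ (T.I R).corrRegs) :
    v.id ∈ T.allNames \ (T.I T.root).names := by
  rcases hv with (hn | hc') | hio
  · refine ⟨hT.names_ideal_subset R hn, fun hroot => hlt.ne ?_⟩
    exact hT.eq_of_mem_names (hT.ideal_names R hn) (hT.ideal_names _ hroot)
  · exact absurd hc' hc
  · obtain ⟨Q, hQ, -⟩ := exists_parent_of_lt hlt
    have hch := hT.ioRegs_subset_chan hQ (hT.ioRegs_ideal_subset R hio)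
    have hname := (hT.module Q).chan_names v hch
    refine ⟨names_subset_allNames Q hname, fun hroot => ?_⟩
    obtain rfl := hT.eq_of_mem_names hname (hT.ideal_names _ hroot)
    exact (hT.ideal_for _).chan_names v (.inl hch) hroot

theorem notMem_corrRegs_sub_root_of_mem_scope_ideal {R : T.Node} {v : Reg}
    (hv : v ∈ (T.I R).scope) (hc : v ∉ (T.I R).corrRegs) : v ∉ (T.sub T.root).corrRegs := by
  intro hroot
  rcases hv with (hn | hc') | hio
  · exact hT.notMem_allNames_of_mem_corrRegs hroot (hT.names_ideal_subset R hn)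
  · exact hc hc'
  · exact hT.notMem_ioRegs_of_mem_corrRegs hroot (hT.ioRegs_ideal_subset R hio)

theorem permitted_root_of_validSim {R : T.Node} {F : Env} {S : Component} {g : Gate}
    {v : Reg} (hS : ValidSim (T.tilde R) (T.I R) F S) (hg : g ∈ S.gates) (hv : v ∈ g.regs) :
    v.id ∈ T.allNames \ (T.I T.root).names ∨
      (v ∈ (T.sub T.root).corrRegs ∧ g.Preserves v) ∨
      (v ∉ (T.sub T.root).corrRegs ∧ v ∉ (T.I T.root).corrRegs ∧ (T.I T.root).Permits g v) := by
  rcases hS.permitted g hg v hv with hown | ⟨hc, hpres⟩ | ⟨hc, hP⟩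
  · exact .inl (hT.names_tilde_diff_subset R hown)
  · exact .inr (.inl ⟨hT.mem_corrRegs_sub_root_of_tilde_or_ideal hc, hpres⟩)
  · have hscope := (hT.ideal R).mem_scope_of_permits hP
    have hcI : v ∉ (T.I R).corrRegs := fun ⟨r, hr, hrc⟩ => hc r (.inr hr) hrc
    rcases (Fin.le_last R).eq_or_lt with rfl | hlt
    exacts [.inr (.inr ⟨hT.notMem_corrRegs_sub_root_of_mem_scope_ideal hscope hcI, hcI, hP⟩),
      .inl (hT.mem_allNames_diff_of_mem_scope_ideal hlt hscope hcI)]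

end WellFormed

/-! ### Hybrids -/

section Hybrids

variable (σ : T.Node → Env → Component) (E : Env)

variable (T) in
/-- The simulator for `R̃` in its environment `E(R̃)`. -/
noncomputable def simAt (R : T.Node) : Component := σ R (T.envAt σ E R)

variable (T) in
/-- The hybrid between `E + P`, for `j = 0`, and `E + I(P)` with all the simulators, for
`j = T.k + 1`, in which the first `j` nodes of the traversal have been replaced. -/
noncomputable def hybrid (j : ℕ) : Component :=
  E.toComponent + stage (fun R => (T.M R).toComponent) (fun R => (T.I R).toComponent) j +
    T.simulators σ E j

theorem simulators_succ (Q : T.Node) :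
    T.simulators σ E (Q + 1) = T.simulators σ E Q + T.simAt σ E Q := by
  rw [simulators, dif_pos Q.isLt]
  rfl

theorem simulators_eq_sum {j : ℕ} (hj : j ≤ T.k + 1) :
    T.simulators σ E j =
      ∑ R ∈ Finset.univ.filter (fun R : T.Node => (R : ℕ) < j), T.simAt σ E R := by
  induction j with
  | zero => simp [simulators]
  | succ j ih =>
    let Q : T.Node := ⟨j, hj⟩
    have hQ : (Finset.univ.filter fun R : T.Node => (R : ℕ) < j + 1) =
        Finset.cons Q (Finset.univ.filter fun R => (R : ℕ) < j) (by simp [Q]) := by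
      ext R
      simp [Q, Fin.ext_iff, le_iff_eq_or_lt]
    rw [hQ, Finset.sum_cons, ← ih (by omega)]
    exact (simulators_succ σ E Q).trans (add_comm _ _)

theorem simulators_val (Q : T.Node) :
    T.simulators σ E Q = ∑ R with R < Q, T.simAt σ E R :=
  simulators_eq_sum σ E Q.isLt.le

theorem simulators_card : T.simulators σ E (T.k + 1) = ∑ R, T.simAt σ E R := by
  rw [simulators_eq_sum σ E le_rfl, Finset.filter_true_of_mem fun R _ => R.isLt]

theorem context_eq_stageContext (Q : T.Node) :
    T.context Q =
      stageContext (fun R => (T.M R).toComponent) (fun R => (T.I R).toComponent) Q := by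
  rw [context, Component.sum_eq_finset_sum, Component.sum_eq_finset_sum, stageContext, pending]

theorem toComponent_envAt (Q : T.Node) : (T.envAt σ E Q).toComponent = E.toComponent +
    stageContext (fun R => (T.M R).toComponent) (fun R => (T.I R).toComponent) Q +
      T.simulators σ E Q := by
  rw [envAt, context_eq_stageContext]

theorem hybrid_zero : T.hybrid σ E 0 = E.toComponent + (T.sub T.root).toComponent := by
  rw [hybrid, stage_zero, simulators, add_zero, sub_root_eq_sum, Protocol.toComponent_sum]

theorem hybrid_card : T.hybrid σ E (T.k + 1) =
    E.toComponent + (T.I T.root).toComponent + T.simulators σ E (T.k + 1) := by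
  rw [hybrid, stage_card]

theorem envAt_add_tilde (Q : T.Node) :
    (T.envAt σ E Q).toComponent + (T.tilde Q).toComponent = T.hybrid σ E Q := by
  rw [hybrid, stage_val, toComponent_envAt, tilde_eq_add_sum,
    Protocol.toComponent_add, Protocol.toComponent_sum]
  abel

theorem envAt_add_ideal (Q : T.Node) :
    (T.envAt σ E Q).toComponent + (T.I Q).toComponent + T.simAt σ E Q =
      T.hybrid σ E (Q + 1) := by
  rw [hybrid, stage_succ, simulators_succ, toComponent_envAt]
  abel

theorem envAt_eq_sum (Q : T.Node) : (T.envAt σ E Q).toComponent =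
    E.toComponent + (∑ R with Q < R, (T.M R).toComponent +
      ∑ R ∈ T.pending Q, (T.I R).toComponent) + ∑ R with R < Q, T.simAt σ E R := by
  rw [toComponent_envAt, simulators_val, stageContext]

end Hybrids

/-! ### Validity of the hybrid environments and of the composed simulator -/

section Validity

variable {σ : T.Node → Env → Component} {E : Env}

/-- The choice `σ` gives a valid simulator for `R̃` in its environment `E(R̃)`. -/
abbrev ValidSimAt (σ : T.Node → Env → Component) (E : Env) (R : T.Node) : Prop :=
  ValidSim (T.tilde R) (T.I R) (T.envAt σ E R) (T.simAt σ E R)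

theorem mem_ids_of_mem_ids_envAt {Q : T.Node} {a : ℕ} (ha : a ∈ (T.envAt σ E Q).ids) :
    a ∈ E.ids ∨ (∃ R, a ∈ (T.M R).toComponent.ids) ∨
      (∃ R < Q, a ∈ (T.I R).toComponent.ids) ∨ ∃ R < Q, a ∈ (T.simAt σ E R).ids := by
  simp only [envAt_eq_sum, Component.mem_ids_add, Component.mem_ids_sum, Finset.mem_filter,
    mem_pending] at ha
  grind

variable (hT : T.WellFormed)
include hT

theorem mem_ids_tilde_of_mem_ids_envAt (hE : ValidEnv (T.sub T.root) E) {Q R : T.Node}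
    (hlt : R < Q) (hS : ∀ R' < R, ValidSimAt σ E R') {a : ℕ} (ha : a ∈ (T.envAt σ E R).ids)
    (hn : a ∈ (T.tilde Q).names) : a ∈ (T.tilde Q).toComponent.ids := by
  rcases mem_ids_of_mem_ids_envAt ha with ha | ⟨R', ha⟩ | ⟨R', hR', ha⟩ | ⟨R', hR', ha⟩
  · obtain ⟨g, hg, rfl⟩ := Component.mem_ids.1 ha
    exact absurd hn ((hT.respects_tilde hE.respects Q).own_gates g hg)
  · exact hT.mem_ids_tilde_of_module ha hn
  · exact hT.mem_ids_tilde_of_ideal (hR'.trans hlt) ha hn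
  · obtain ⟨g, hg, rfl⟩ := Component.mem_ids.1 ha
    exact absurd hn (Set.disjoint_left.1 (hT.disjoint_names_tilde (hR'.trans hlt))
      ((hS R' hR').own_gates g hg))

theorem simAt_respects_tilde (hE : ValidEnv (T.sub T.root) E) {Q R : T.Node} (hlt : R < Q)
    (hS : ∀ R' < Q, ValidSimAt σ E R') : (T.simAt σ E R).Respects (T.tilde Q) :=
  hT.respects_tilde_of_validSim hlt (hS R hlt) fun _ =>
    mem_ids_tilde_of_mem_ids_envAt hT hE hlt fun R' hR' => hS R' (hR'.trans hlt)

theorem envAt_respects_tilde (hE : ValidEnv (T.sub T.root) E) {Q : T.Node}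
    (hS : ∀ R < Q, ValidSimAt σ E R) : (T.envAt σ E Q).toComponent.Respects (T.tilde Q) := by
  rw [envAt_eq_sum]
  refine ((hT.respects_tilde hE.respects Q).add (.add (.sum fun R hR => ?_)
    (.sum fun R hR => hT.ideal_respects_tilde hR))).add (.sum fun R hR => ?_)
  · exact hT.module_respects_tilde (Finset.mem_filter.1 hR).2
  · exact simAt_respects_tilde hT hE (Finset.mem_filter.1 hR).2 hS

theorem output_tilde (hE : ValidEnv (T.sub T.root) E) (Q : T.Node) :
    E.Z.IsBit ∧ E.Z.id ∉ (T.tilde Q).names ∧ ∀ r ∈ (T.tilde Q).roles, E.Z ∉ r.regs := by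
  obtain ⟨hbit, hname, hreg⟩ := hE.output
  rw [names_sub_root] at hname
  have hmodule : ∀ R, ∀ r ∈ (T.M R).roles, E.Z ∉ r.regs :=
    fun R r hr => hreg r (mem_roles_sub_root.2 ⟨R, hr⟩)
  refine ⟨hbit, fun h => hname (hT.names_tilde_subset Q h), fun r hr hZ => ?_⟩
  rcases mem_roles_tilde.1 hr with hr | ⟨R, -, hr⟩
  · exact hmodule Q r hr hZ
  · obtain ⟨R', r', hr', hZ'⟩ := hT.exists_module_role_of_mem_scope_ideal
      (Protocol.mem_scope_of_mem_regs hr hZ) hname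
    exact hmodule R' r' hr' hZ'

omit hT in
theorem hybrid_isCircuit (hE : ValidEnv (T.sub T.root) E) {Q : T.Node}
    (hS : ∀ R < Q, ValidSimAt σ E R) : (T.hybrid σ E Q).IsCircuit := by
  obtain ⟨j, hj⟩ := Q
  cases j with
  | zero => exact hybrid_zero σ E ▸ hE.circuit
  | succ j =>
    let R : T.Node := ⟨j, (Nat.lt_succ_self j).trans hj⟩
    exact envAt_add_ideal σ E R ▸ (hS R (Nat.lt_succ_self j)).circuit

theorem validEnv_envAt (hE : ValidEnv (T.sub T.root) E) {Q : T.Node}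
    (hS : ∀ R < Q, ValidSimAt σ E R) : ValidEnv (T.tilde Q) (T.envAt σ E Q) where
  output := output_tilde hT hE Q
  own_gates := (envAt_respects_tilde hT hE hS).own_gates
  permitted := (envAt_respects_tilde hT hE hS).permitted
  order x a b hab :=
    have h := (envAt_respects_tilde hT hE hS).order x a b hab
    ⟨h a (.inl rfl), h b (.inr rfl)⟩
  circuit := by
    rw [envAt_add_tilde]
    exact hybrid_isCircuit hE hS

theorem validSimAt_of_simulates (hE : ValidEnv (T.sub T.root) E) {ε : T.Node → Env → ℝ}
    (hσ : ∀ Q, Simulates (T.tilde Q) (T.I Q) (ε Q) (σ Q)) (Q : T.Node) : ValidSimAt σ E Q := by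
  induction Q using WellFoundedLT.induction with
  | ind Q ih => exact (hσ Q _ (validEnv_envAt hT hE ih)).1

theorem mem_ids_or_allNames_of_mem_ids_envAt {Q : T.Node} {a : ℕ}
    (ha : a ∈ (T.envAt σ E Q).ids) :
    a ∈ (∑ R, T.simAt σ E R).ids ∨ a ∈ E.ids ∨ a ∈ T.allNames := by
  rcases mem_ids_of_mem_ids_envAt ha with ha | ⟨R, ha⟩ | ⟨R, -, ha⟩ | ⟨R, -, ha⟩
  · exact .inr (.inl ha)
  · exact .inr (.inr (names_subset_allNames R ((hT.module R).ids_subset_names ha)))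
  · exact .inr (.inr (hT.names_ideal_subset R ((hT.ideal R).ids_subset_names ha)))
  · exact .inl (Component.mem_ids_sum.2 ⟨R, Finset.mem_univ R, ha⟩)

theorem validSim_simulators (hE : ValidEnv (T.sub T.root) E) (hS : ∀ R, ValidSimAt σ E R) :
    ValidSim (T.sub T.root) (T.I T.root) E (T.simulators σ E (T.k + 1)) where
  own_gates g hg := by
    rw [simulators_card, Component.mem_gates_sum] at hg
    obtain ⟨R, -, hg⟩ := hg
    exact names_sub_root ▸ hT.names_tilde_diff_subset R ((hS R).own_gates g hg)
  permitted g hg v hv := by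
    rw [simulators_card, Component.mem_gates_sum] at hg
    obtain ⟨R, -, hg⟩ := hg
    rw [names_sub_root]
    rcases hT.permitted_root_of_validSim (hS R) hg hv with hn | ⟨⟨r, hr, hc⟩, hpres⟩ | ⟨hc, hcI, hP⟩
    · exact .inl hn
    · exact .inr (.inl ⟨⟨r, .inl hr, hc⟩, hpres⟩)
    · refine .inr (.inr ⟨?_, hP⟩)
      rintro r (hr | hr) hrc
      exacts [hc ⟨r, hr, hrc⟩, hcI ⟨r, hr, hrc⟩]
  order x a b hab d hd := by
    rw [simulators_card] at hab ⊢
    obtain ⟨R, -, hab⟩ := Component.rel_sum.1 hab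
    obtain ⟨hSEP, hI⟩ := (hS R).order x a b hab d hd
    refine ⟨?_, fun hroot => ?_⟩
    · rw [names_sub_root]
      rcases hSEP with hids | hids | hn
      exacts [.inl (Component.mem_ids_sum.2 ⟨R, Finset.mem_univ R, hids⟩),
        mem_ids_or_allNames_of_mem_ids_envAt hT hids, .inr (.inr (hT.names_tilde_subset R hn))]
    · rcases (Fin.le_last R).eq_or_lt with rfl | hlt
      · exact hI hroot
      · have hrespects := simAt_respects_tilde hT hE hlt fun R' _ => hS R'
        exact (hT.ideal_for T.root).gate_names d (hrespects.order x a b hab d hd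
          (mem_names_tilde.2 (.inl (hT.ideal_names _ hroot)))) hroot
  circuit := by
    rw [← hybrid_card]
    exact envAt_add_ideal σ E T.root ▸ (hS T.root).circuit

theorem advantage_simulators_le (hE : ValidEnv (T.sub T.root) E) {ε : T.Node → Env → ℝ}
    (hσ : ∀ Q, Simulates (T.tilde Q) (T.I Q) (ε Q) (σ Q)) :
    advantage (T.sub T.root) (T.I T.root) E (T.simulators σ E (T.k + 1)) ≤
      ∑ Q, ε Q (T.envAt σ E Q) := by
  let p : ℕ → ℝ := fun j => (T.hybrid σ E j).probZero E.Z
  have hstep : ∀ Q : T.Node, |p Q - p (Q + 1)| ≤ ε Q (T.envAt σ E Q) := by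
    intro Q
    have hvalid := validEnv_envAt hT hE fun R (_ : R < Q) => validSimAt_of_simulates hT hE hσ R
    have hadv : advantage (T.tilde Q) (T.I Q) (T.envAt σ E Q) (T.simAt σ E Q) ≤ _ :=
      (hσ Q _ hvalid).2
    rwa [advantage, envAt_add_tilde, envAt_add_ideal] at hadv
  calc advantage (T.sub T.root) (T.I T.root) E (T.simulators σ E (T.k + 1))
      = |p 0 - p (T.k + 1)| := by rw [advantage, ← hybrid_zero σ, ← hybrid_card]
    _ = |∑ Q : T.Node, (p Q - p (Q + 1))| := by
      rw [Fin.sum_univ_eq_sum_range fun j => p j - p (j + 1), Finset.sum_range_sub']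
    _ ≤ ∑ Q : T.Node, |p Q - p (Q + 1)| := Finset.abs_sum_le_sum_abs _ _
    _ ≤ ∑ Q, ε Q (T.envAt σ E Q) := Finset.sum_le_sum fun Q _ => hstep Q

end Validity

end ProtocolTree

theorem SecurelyRealizes.exists_simulates {P I : Protocol} {ε : Env → ℝ}
    (h : SecurelyRealizes P I ε) : ∃ σ, Simulates P I ε σ := by
  choose! σ hσ using h
  exact ⟨σ, hσ⟩

/-- Here `T n` is the protocol `P` for the value `n` of the security parameter, with its tree of
sub-protocols `Q`, and `ε n Q` is the error of `Q̃` as a function of the environment. If every `Q̃`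
securely realizes `I(Q)`, then simulators for the `Q̃` can be chosen as functions of the environment,
and, whatever the choice, `P` securely realizes `I(P)` with error `∑ Q, ε n Q (E(Q̃))`, where `E(Q̃)`
is determined by `E`, `P` and the chosen simulators of the sub-protocols visited before `Q`. -/
theorem theorem2 (T : ℕ → ProtocolTree) (hT : ∀ n, (T n).WellFormed)
    (ε : (n : ℕ) → (T n).Node → Env → ℝ)
    (h : ∀ n Q, SecurelyRealizes ((T n).tilde Q) ((T n).I Q) (ε n Q)) :
    (∃ σ : (n : ℕ) → (T n).Node → Env → Component,
      ∀ n Q, Simulates ((T n).tilde Q) ((T n).I Q) (ε n Q) (σ n Q)) ∧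
    ∀ σ : (n : ℕ) → (T n).Node → Env → Component,
      (∀ n Q, Simulates ((T n).tilde Q) ((T n).I Q) (ε n Q) (σ n Q)) →
      ∀ n, SecurelyRealizes ((T n).sub (T n).root) ((T n).I (T n).root)
        (fun E => ∑ Q, ε n Q ((T n).envAt (σ n) E Q)) := by
  refine ⟨?_, fun σ hσ n E hE => ⟨(T n).simulators (σ n) E ((T n).k + 1), ?_, ?_⟩⟩
  · choose σ hσ using fun n Q => (h n Q).exists_simulates
    exact ⟨σ, hσ⟩
  · exact ProtocolTree.validSim_simulators (hT n) hE
      (ProtocolTree.validSimAt_of_simulates (hT n) hE (hσ n))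
  · exact ProtocolTree.advantage_simulators_le (hT n) hE (hσ n)
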